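/- Let $(R,\mathfrak m)$ be a commutative noetherian local ring and let $M$ be an arbitrary $R$-module. An $R$-module $A$ is called separated if $\bigcap_{n\ge 1}\mathfrak m^nA=0$, and $M$ is called totally separated if $X\otimes_R M$ is separated for every finitely generated $R$-module $X$. An $R$-linear map $f:A\to B$ is a pure monomorphism if $X\otimes_R f$ is injective for every $R$-module $X$. An $R$-module $N$ is pure-injective if every linear map $A\to N$ extends along every pure monomorphism $A\to B$. A pure-injective hull of $M$ is a pure monomorphism $M\to N$ with $N$ pure-injective that is pure-essential, i.e. the only submodule $X\subseteq N$ for which the composite $M\to N\to N/X$ is a pure monomorphism is $X=0$. Then the following are equivalent: (i) $M$ is totally separated; (ii) the canonical map $M\to\prod_{n\ge 1}M/\mathfrak m^nM$ is a pure monomorphism; (iii) the pure-injective hull of $M$ is separated, that is, $M$ has a pure-injective hull $M\to N$ with $N$ separated; (iii') every pure-injective hull $N$ of $M$ is separated. -/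

import Mathlib

open scoped TensorProduct

universe u v w

/-- A linear map `f : M → N` is a pure monomorphism if `X ⊗ f : X ⊗ M → X ⊗ N` is injective for
every `R`-module `X` (the case `X = R` says that `f` itself is injective). -/
def IsPureMono {R : Type u} [CommRing R] {M : Type v} [AddCommGroup M] [Module R M]
    {N : Type w} [AddCommGroup N] [Module R N] (f : M →ₗ[R] N) : Prop :=
  ∀ (X : Type u) [AddCommGroup X] [Module R X], Function.Injective (f.lTensor X)

/-- `N` is pure-injective if every linear map `A → N` extends along every pure monomorphism
`A → B`. -/
def IsPureInjective (R : Type u) [CommRing R] (N : Type w) [AddCommGroup N] [Module R N] : Prop :=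
  ∀ (A B : Type (max u w)) [AddCommGroup A] [Module R A] [AddCommGroup B] [Module R B]
    (i : A →ₗ[R] B) (g : A →ₗ[R] N), IsPureMono i → ∃ h : B →ₗ[R] N, h ∘ₗ i = g

/-- `f : M → N` is a pure-essential extension: it is a pure monomorphism, and every submodule `X`
of `N` for which `M → N → N / X` is still a pure monomorphism is zero. (Since a pure monomorphism
is injective, the condition on `X` says that `X ∩ M = 0` and that `(X ⊕ M) / X` is pure
in `N / X`.) -/
def IsPureEssential {R : Type u} [CommRing R] {M : Type v} [AddCommGroup M] [Module R M]
    {N : Type w} [AddCommGroup N] [Module R N] (f : M →ₗ[R] N) : Prop :=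
  IsPureMono f ∧ ∀ X : Submodule R N, IsPureMono (X.mkQ ∘ₗ f) → X = ⊥

/-- `f : M → N` is a pure-injective hull of `M`: a pure-essential extension of `M` by a
pure-injective module. -/
def IsPureInjectiveHull {R : Type u} [CommRing R] {M : Type v} [AddCommGroup M] [Module R M]
    {N : Type w} [AddCommGroup N] [Module R N] (f : M →ₗ[R] N) : Prop :=
  IsPureEssential f ∧ IsPureInjective R N

/-- A module `M` over a local ring is separated if the intersection of all `𝔪 ^ n M` is zero. -/
abbrev IsSeparatedModule (R : Type u) [CommRing R] [IsLocalRing R]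
    (M : Type v) [AddCommGroup M] [Module R M] : Prop :=
  IsHausdorff (IsLocalRing.maximalIdeal R) M

/-- `M` is totally separated if `X ⊗ M` is separated for every finitely generated `X`. -/
def IsTotallySeparatedModule (R : Type u) [CommRing R] [IsLocalRing R]
    (M : Type v) [AddCommGroup M] [Module R M] : Prop :=
  ∀ (X : Type u) [AddCommGroup X] [Module R X] [Module.Finite R X],
    IsSeparatedModule R (X ⊗[R] M)

/-- The canonical map `M → ∏_{n ≥ 1} M / 𝔪 ^ n M`. -/
def toProdQuotients (R : Type u) [CommRing R] [IsLocalRing R]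
    (M : Type v) [AddCommGroup M] [Module R M] :
    M →ₗ[R] ((n : ℕ+) →
      M ⧸ (IsLocalRing.maximalIdeal R ^ (n : ℕ) • ⊤ : Submodule R M)) :=
  LinearMap.pi fun n : ℕ+ =>
    (IsLocalRing.maximalIdeal R ^ (n : ℕ) • ⊤ : Submodule R M).mkQ

/-! For finitely generated `X`, right exactness gives `X ⊗ M/𝔪ⁿM = (X ⊗ M)/𝔪ⁿ(X ⊗ M)`, and
noetherianity makes `X ⊗ ∏ Nᵢ → ∏ (X ⊗ Nᵢ)` injective; purity need only be tested on such `X`. Hence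
(i) ⇔ (ii).

(iii) ⇒ (i): a pure-injective `N` carries a linear limit functional `N ^ ℕ → N` that fixes constants
and kills eventually zero sequences. If `t ∈ X ⊗ N` has coefficients in `𝔪ⁿN` for every `n`, taking
limits of these coefficients recovers `t`. The limits lie in `⋂ 𝔪ʲN = 0`, so `t = 0`; pure
submodules inherit this.

(i) ⇒ (iii'): characters of `M ⊗ Z`, with `Z` finitely generated and killed by a power of `𝔪`, give
a pure map from `M` to a product of duals `Z⋆`. It extends to any pure-essential `N`, where
essentiality makes the extension injective; the product is separated.

(iii') ⇒ (iii) needs a hull to exist. `M` is pure in some `U⋆`, with `U` a direct sum of finitely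
generated modules. Endomorphisms of `U⋆` are the characters of `U ⊗ U⋆`, so an essential closure of
the image of `U ⊗ M`, taken over `End U`, is cut out by an idempotent of `U⋆`; its range is the hull
(`IsPureMono.exists_isPureInjectiveHull`). -/

/-! ### Pure monomorphisms and pure-injectivity -/

section Purity

variable {R : Type u} [CommRing R]

/-- If `X ⊗ f` is injective for finitely generated `X`, then it is injective for every `X`, in
any universe. -/
theorem lTensor_injective_of_finite {M N : Type*} [AddCommGroup M] [Module R M]
    [AddCommGroup N] [Module R N] (f : M →ₗ[R] N)
    (h : ∀ (X : Type u) [AddCommGroup X] [Module R X] [Module.Finite R X],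
      Function.Injective (f.lTensor X))
    (X : Type*) [AddCommGroup X] [Module R X] : Function.Injective (f.lTensor X) := by
  rw [injective_iff_map_eq_zero]
  intro t ht
  obtain ⟨P, hP, s, rfl⟩ := TensorProduct.exists_of_fg t
  have h1 : (P.subtype.rTensor N) (f.lTensor P s) = 0 := by
    rw [← ht, ← LinearMap.comp_apply, ← LinearMap.comp_apply, LinearMap.rTensor_comp_lTensor,
      LinearMap.lTensor_comp_rTensor]
  obtain ⟨Q, hPQ, hQ, h2⟩ := TensorProduct.eq_zero_of_fg_of_subtype_eq_zero hP h1
  have h3 : f.lTensor Q ((Submodule.inclusion hPQ).rTensor M s) = 0 := by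
    rw [← h2, ← LinearMap.comp_apply, ← LinearMap.comp_apply, LinearMap.rTensor_comp_lTensor,
      LinearMap.lTensor_comp_rTensor]
  have : Module.Finite R Q := Module.Finite.iff_fg.2 hQ
  -- `Q` may live in any universe; a quotient of `R ^ n` lives in `u`, where `h` applies.
  obtain ⟨n, S, ⟨e⟩⟩ := Module.Finite.exists_fin_quot_equiv R Q
  have h4 : e.symm.toLinearMap.rTensor M ((Submodule.inclusion hPQ).rTensor M s) = 0 := by
    apply (injective_iff_map_eq_zero _).1 (h ((Fin n → R) ⧸ S))
    rw [← LinearMap.comp_apply, LinearMap.lTensor_comp_rTensor, ← LinearMap.rTensor_comp_lTensor,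
      LinearMap.comp_apply, h3, map_zero]
  have h5 : (Submodule.inclusion hPQ).rTensor M s = 0 := by
    apply (injective_iff_map_eq_zero (e.symm.rTensor M)).1 (e.symm.rTensor M).injective
    exact h4
  have h6 : P.subtype = Q.subtype ∘ₗ Submodule.inclusion hPQ := rfl
  rw [h6, LinearMap.rTensor_comp, LinearMap.comp_apply, h5, map_zero]

theorem IsPureMono.lTensor_injective {M : Type v} {N : Type w} [AddCommGroup M] [Module R M]
    [AddCommGroup N] [Module R N] {f : M →ₗ[R] N} (hf : IsPureMono f)
    (X : Type*) [AddCommGroup X] [Module R X] : Function.Injective (f.lTensor X) :=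
  lTensor_injective_of_finite f (fun X _ _ _ => hf X) X

theorem IsPureMono.rTensor_injective {M : Type v} {N : Type w} [AddCommGroup M] [Module R M]
    [AddCommGroup N] [Module R N] {f : M →ₗ[R] N} (hf : IsPureMono f)
    (X : Type*) [AddCommGroup X] [Module R X] : Function.Injective (f.rTensor X) :=
  (LinearMap.lTensor_inj_iff_rTensor_inj X f).1 (hf.lTensor_injective X)

theorem IsPureMono.of_comp {M N P : Type*} [AddCommGroup M] [Module R M] [AddCommGroup N]
    [Module R N] [AddCommGroup P] [Module R P] {f : M →ₗ[R] N} {g : N →ₗ[R] P}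
    (h : IsPureMono (g ∘ₗ f)) : IsPureMono f := by
  intro X _ _
  have := h X
  rw [LinearMap.lTensor_comp, LinearMap.coe_comp] at this
  exact this.of_comp

/-- Linear maps to a character module extend along pure monomorphisms. -/
theorem IsPureMono.exists_extension_characterModule {A B : Type*} [AddCommGroup A] [Module R A]
    [AddCommGroup B] [Module R B] {i : A →ₗ[R] B} (hi : IsPureMono i)
    {U : Type*} [AddCommGroup U] [Module R U] (g : A →ₗ[R] CharacterModule U) :
    ∃ h : B →ₗ[R] CharacterModule U, h ∘ₗ i = g :=
  rTensor_injective_iff_lcomp_surjective.1 (hi.rTensor_injective U) g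

/-- A retract of a pure-injective module is pure-injective. -/
theorem IsPureInjective.of_retract {E N : Type w} [AddCommGroup E] [Module R E] [AddCommGroup N]
    [Module R N] (hE : IsPureInjective R E) (s : N →ₗ[R] E) (r : E →ₗ[R] N)
    (hrs : r ∘ₗ s = LinearMap.id) : IsPureInjective R N := by
  intro A B _ _ _ _ i g hi
  obtain ⟨h, hh⟩ := hE A B i (s ∘ₗ g) hi
  refine ⟨r ∘ₗ h, ?_⟩
  rw [LinearMap.comp_assoc, hh, ← LinearMap.comp_assoc, hrs, LinearMap.id_comp]

end Purity

/-! ### Tensors with a finitely presented module -/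

section Presentation

variable {R : Type u} [CommRing R]

/-- Over a noetherian ring, the vanishing of `∑ xᵢ ⊗ nᵢ` for a generating family `x` is governed by
finitely many relations, chosen independently of `n`. -/
theorem exists_finite_presentation_tensor [IsNoetherianRing R] (X : Type*) [AddCommGroup X]
    [Module R X] [Module.Finite R X] :
    ∃ (k m : ℕ) (x : Fin k → X) (A : Fin m → Fin k → R),
      Submodule.span R (Set.range x) = ⊤ ∧ (∀ l, ∑ i, A l i • x i = 0) ∧
      (∀ a : Fin k → R, ∑ i, a i • x i = 0 → ∃ b : Fin m → R, ∑ l, b l • A l = a) ∧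
      ∀ (N : Type v) [AddCommGroup N] [Module R N] (n : Fin k → N),
        ∑ i, x i ⊗ₜ[R] n i = 0 → ∃ y : Fin m → N, ∀ i, n i = ∑ l, A l i • y l := by
  obtain ⟨k, x, hx⟩ := Module.Finite.exists_fin (R := R) (M := X)
  obtain ⟨m, A, hA⟩ := Submodule.fg_iff_exists_fin_generating_family.1
    (IsNoetherian.noetherian (LinearMap.ker (Fintype.linearCombination R x)))
  have hA' : ∀ l, ∑ i, A l i • x i = 0 := by
    intro l
    have : A l ∈ LinearMap.ker (Fintype.linearCombination R x) := by
      rw [← hA]; exact Submodule.subset_span ⟨l, rfl⟩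
    simpa [Fintype.linearCombination_apply] using this
  have hgen : ∀ a : Fin k → R, ∑ i, a i • x i = 0 → ∃ b : Fin m → R, ∑ l, b l • A l = a := by
    intro a ha
    have : a ∈ Submodule.span R (Set.range A) := by
      rw [hA]
      simpa [Fintype.linearCombination_apply] using ha
    exact (Submodule.mem_span_range_iff_exists_fun R).1 this
  refine ⟨k, m, x, A, hx, hA', hgen, ?_⟩
  intro N _ _ n hn
  obtain ⟨p, a, y, h1, h2⟩ := TensorProduct.vanishesTrivially_of_sum_tmul_eq_zero R hx hn
  have h3 := fun j => hgen (fun i => a i j) (h2 j)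
  choose b hb using h3
  refine ⟨fun l => ∑ j, b j l • y j, fun i => ?_⟩
  rw [h1 i]
  simp_rw [Finset.smul_sum]
  rw [Finset.sum_comm]
  refine Finset.sum_congr rfl fun j _ => ?_
  rw [← congrFun (hb j) i, Finset.sum_apply, Finset.sum_smul]
  refine Finset.sum_congr rfl fun l _ => ?_
  simp [smul_smul, mul_comm]

/-- Every tensor is a combination of the members of a generating family of the left factor. -/
theorem exists_sum_tmul_of_span_eq_top {X : Type*} [AddCommGroup X] [Module R X] {k : ℕ}
    {x : Fin k → X} (hx : Submodule.span R (Set.range x) = ⊤) {N : Type*} [AddCommGroup N]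
    [Module R N] (t : X ⊗[R] N) : ∃ n : Fin k → N, t = ∑ i, x i ⊗ₜ[R] n i := by
  induction t with
  | zero => exact ⟨0, by simp⟩
  | tmul a b =>
    have : a ∈ Submodule.span R (Set.range x) := hx ▸ Submodule.mem_top
    obtain ⟨c, rfl⟩ := (Submodule.mem_span_range_iff_exists_fun R).1 this
    refine ⟨fun i => c i • b, ?_⟩
    simp [TensorProduct.sum_tmul, TensorProduct.smul_tmul]
  | add a b ha hb =>
    obtain ⟨m, rfl⟩ := ha
    obtain ⟨n, rfl⟩ := hb
    exact ⟨m + n, by simp [TensorProduct.tmul_add, Finset.sum_add_distrib]⟩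

theorem sum_tmul_eq_zero_of_relations {X N : Type*} [AddCommGroup X] [Module R X] [AddCommGroup N]
    [Module R N] {k m : ℕ} {x : Fin k → X} {A : Fin m → Fin k → R}
    (hA : ∀ l, ∑ i, A l i • x i = 0) {n : Fin k → N} {y : Fin m → N}
    (hy : ∀ i, n i = ∑ l, A l i • y l) : ∑ i, x i ⊗ₜ[R] n i = 0 :=
  TensorProduct.sum_tmul_eq_zero_of_vanishesTrivially R
    ⟨m, fun i l => A l i, y, hy, hA⟩

/-- For finitely generated `X` over a noetherian ring, an element of `X ⊗ ∏ N i` is determined by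
its components in the `X ⊗ N i`. -/
theorem eq_zero_of_forall_lTensor_proj_eq_zero [IsNoetherianRing R] {X : Type*} [AddCommGroup X]
    [Module R X] [Module.Finite R X] {ι : Type*} {N : ι → Type v} [∀ i, AddCommGroup (N i)]
    [∀ i, Module R (N i)] (t : X ⊗[R] (∀ i, N i))
    (ht : ∀ i, (LinearMap.proj (R := R) (φ := N) i).lTensor X t = 0) : t = 0 := by
  obtain ⟨k, m, x, A, hx, hA, -, hrel⟩ := exists_finite_presentation_tensor.{u, v} (R := R) X
  obtain ⟨n, rfl⟩ := exists_sum_tmul_of_span_eq_top hx t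
  have h : ∀ a, ∃ y : Fin m → N a, ∀ i, n i a = ∑ l, A l i • y l := by
    intro a
    apply hrel (N a) (fun i => n i a)
    simpa using ht a
  choose y hy using h
  refine sum_tmul_eq_zero_of_relations hA (y := fun l a => y a l) fun i => ?_
  ext a
  simp [hy]

/-- A character vanishing on the kernel of `f` factors through `f`. -/
theorem exists_character_comp_eq {A B : Type*} [AddCommGroup A] [Module R A] [AddCommGroup B]
    [Module R B] (f : A →ₗ[R] B) (c : CharacterModule A) (hc : ∀ a, f a = 0 → c a = 0) :
    ∃ p : CharacterModule B, ∀ a, p (f a) = c a := by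
  have hinj : Function.Injective ((LinearMap.ker f).liftQ f le_rfl) :=
    LinearMap.ker_eq_bot.1 (Submodule.ker_liftQ_eq_bot _ _ _ le_rfl)
  let c' : CharacterModule (A ⧸ LinearMap.ker f) :=
    QuotientAddGroup.lift (LinearMap.ker f).toAddSubgroup c fun a ha => hc a ha
  obtain ⟨p, hp⟩ := CharacterModule.dual_surjective_of_injective _ hinj c'
  exact ⟨p, fun a => DFunLike.congr_fun hp (Submodule.Quotient.mk a)⟩

/-- The evaluation pairing `D ⊗ D⋆ → ℚ ⧸ ℤ`. -/
noncomputable def evalCharacter (R : Type u) [CommRing R] (D : Type*) [AddCommGroup D]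
    [Module R D] : CharacterModule (D ⊗[R] CharacterModule D) :=
  CharacterModule.dual (TensorProduct.comm R D (CharacterModule D)).toLinearMap
    (CharacterModule.uncurry LinearMap.id)

@[simp]
theorem evalCharacter_tmul {D : Type*} [AddCommGroup D] [Module R D] (d : D)
    (c : CharacterModule D) : evalCharacter R D (d ⊗ₜ c) = c d := rfl

/-- For finitely generated `X` over a noetherian ring, the natural map
`X ⊗ D⋆ → Hom(X, D)⋆` is injective. -/
theorem eq_zero_of_forall_evalCharacter_rTensor_eq_zero [IsNoetherianRing R] {X : Type*}
    [AddCommGroup X] [Module R X] [Module.Finite R X] {D : Type*} [AddCommGroup D] [Module R D]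
    (t : X ⊗[R] CharacterModule D)
    (ht : ∀ f : X →ₗ[R] D, evalCharacter R D (f.rTensor (CharacterModule D) t) = 0) : t = 0 := by
  obtain ⟨k, m, x, A, hx, hA, hgen, -⟩ := exists_finite_presentation_tensor.{u, u} (R := R) X
  obtain ⟨c, rfl⟩ := exists_sum_tmul_of_span_eq_top hx t
  have hsurj : Function.Surjective (Fintype.linearCombination R x) := by
    rw [← LinearMap.range_eq_top, Fintype.range_linearCombination, hx]
  -- Below, `α` has kernel `Hom(X, D)` and `cc` is the pairing with `t`. Since `cc` vanishes on that
  -- kernel it factors through `α`, and the components of the factor `p` exhibit `c` as a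
  -- combination of relations.
  have hlift : ∀ d : Fin k → D, (∀ l, ∑ i, A l i • d i = 0) → ∃ f : X →ₗ[R] D,
      ∀ i, f (x i) = d i := by
    intro d hd
    have hle : LinearMap.ker (Fintype.linearCombination R x) ≤
        LinearMap.ker (Fintype.linearCombination R d) := by
      intro a ha
      obtain ⟨b, rfl⟩ := hgen a (by simpa [Fintype.linearCombination_apply] using ha)
      have : ∀ l, Fintype.linearCombination R d (A l) = 0 := fun l => by
        simpa [Fintype.linearCombination_apply] using hd l
      simp [map_sum, this]
    refine ⟨(Submodule.liftQ _ _ hle) ∘ₗ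
      ((Fintype.linearCombination R x).quotKerEquivOfSurjective hsurj).symm.toLinearMap,
      fun i => ?_⟩
    have : ((Fintype.linearCombination R x).quotKerEquivOfSurjective hsurj).symm (x i) =
        Submodule.Quotient.mk (Pi.single i 1) := by
      rw [LinearEquiv.symm_apply_eq]
      simp
    simp [this]
  let α : (Fin k → D) →ₗ[R] (Fin m → D) :=
    LinearMap.pi fun l => ∑ i, A l i • LinearMap.proj i
  let cc : CharacterModule (Fin k → D) :=
    ∑ i, CharacterModule.dual (LinearMap.proj (R := R) (φ := fun _ : Fin k => D) i) (c i)
  have hsum : ∀ {n : ℕ} {Z : Type _} [AddCommGroup Z] (g : Fin n → CharacterModule Z) (z : Z),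
      (∑ i, g i) z = ∑ i, g i z := fun g z =>
    map_sum (AddMonoidHom.eval z : _ →+ _) g Finset.univ
  have hcc : ∀ d, cc d = ∑ i, c i (d i) := fun d => hsum _ _
  obtain ⟨p, hp⟩ := exists_character_comp_eq α cc (by
    intro d hd
    obtain ⟨f, hf⟩ := hlift d (fun l => by simpa [α] using congrFun hd l)
    have := ht f
    simpa [hf, hcc] using this)
  refine sum_tmul_eq_zero_of_relations hA
    (y := fun l => CharacterModule.dual (LinearMap.single R (fun _ : Fin m => D) l) p) fun i => ?_
  ext d
  have h1 : c i d = cc (Pi.single i d) := by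
    rw [hcc, Finset.sum_eq_single i]
    · simp
    · intro j _ hj
      simp [hj]
    · simp
  have h2 : α (Pi.single i d) = ∑ l, Pi.single l (A l i • d) := by
    ext l
    simp only [α, LinearMap.pi_apply, LinearMap.sum_apply, LinearMap.smul_apply,
      LinearMap.proj_apply, Finset.sum_apply]
    rw [Finset.sum_eq_single i, Finset.sum_eq_single l]
    · simp
    · intro j _ hj
      simp [Ne.symm hj]
    · simp
    · intro j _ hj
      simp [hj]
    · simp
  rw [h1, ← hp, h2, map_sum, hsum]
  rfl

end Presentation

/-! ### Separatedness and the product of the `M/𝔪ⁿM` -/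

section Separated

variable {R : Type u} [CommRing R]

theorem LinearMap.apply_mem_smul_top {A B : Type*} [AddCommGroup A] [Module R A] [AddCommGroup B]
    [Module R B] (f : A →ₗ[R] B) {I : Ideal R} {x : A} (hx : x ∈ (I • ⊤ : Submodule R A)) :
    f x ∈ (I • ⊤ : Submodule R B) := by
  have : f x ∈ Submodule.map f (I • ⊤) := Submodule.mem_map_of_mem hx
  rw [Submodule.map_smul''] at this
  exact Submodule.smul_mono le_rfl le_top this

theorem LinearMap.apply_eq_zero_of_mem_smul_top {A B : Type*} [AddCommGroup A] [Module R A]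
    [AddCommGroup B] [Module R B] (f : A →ₗ[R] B) {I : Ideal R} (h : ∀ r ∈ I, ∀ b : B, r • b = 0)
    {x : A} (hx : x ∈ (I • ⊤ : Submodule R A)) : f x = 0 := by
  induction hx using Submodule.smul_induction_on' with
  | smul r hr a _ => rw [map_smul, h r hr]
  | add a _ b _ ha hb => rw [map_add, ha, hb, add_zero]

theorem isHausdorff_iff_mem {I : Ideal R} {A : Type*} [AddCommGroup A] [Module R A] :
    IsHausdorff I A ↔ ∀ x : A, (∀ n : ℕ, x ∈ (I ^ n • ⊤ : Submodule R A)) → x = 0 := by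
  simp only [isHausdorff_iff, SModEq.zero]

theorem IsHausdorff.of_injective {I : Ideal R} {A B : Type*} [AddCommGroup A] [Module R A]
    [AddCommGroup B] [Module R B] (f : A →ₗ[R] B) (hf : Function.Injective f)
    (hB : IsHausdorff I B) : IsHausdorff I A := by
  rw [isHausdorff_iff_mem] at hB ⊢
  intro x hx
  apply hf
  rw [map_zero]
  exact hB _ fun n => f.apply_mem_smul_top (hx n)

theorem smul_mkQ_smul_top_eq_zero {I : Ideal R} {A : Type*} [AddCommGroup A] [Module R A]
    {r : R} (hr : r ∈ I) (b : A ⧸ (I • ⊤ : Submodule R A)) : r • b = 0 := by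
  obtain ⟨a, rfl⟩ := Submodule.Quotient.mk_surjective _ b
  rw [← Submodule.Quotient.mk_smul, Submodule.Quotient.mk_eq_zero]
  exact Submodule.smul_mem_smul hr trivial

theorem smul_tmul_eq_zero_of_right {X N : Type*} [AddCommGroup X] [Module R X] [AddCommGroup N]
    [Module R N] {r : R} (h : ∀ b : N, r • b = 0) (t : X ⊗[R] N) : r • t = 0 := by
  induction t with
  | zero => simp
  | tmul x n => rw [← TensorProduct.tmul_smul, h, TensorProduct.tmul_zero]
  | add a b ha hb => rw [smul_add, ha, hb, add_zero]

/-- By right exactness the kernel is the image of `X ⊗ IM`, which lies in `I(X ⊗ M)`; conversely `I`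
kills `X ⊗ M/IM`. -/
theorem lTensor_mkQ_smul_top_eq_zero_iff {I : Ideal R} {X M : Type*} [AddCommGroup X] [Module R X]
    [AddCommGroup M] [Module R M] (t : X ⊗[R] M) :
    (I • ⊤ : Submodule R M).mkQ.lTensor X t = 0 ↔ t ∈ (I • ⊤ : Submodule R (X ⊗[R] M)) := by
  constructor
  · intro h
    obtain ⟨s, rfl⟩ := (lTensor_exact X (LinearMap.exact_subtype_mkQ (I • ⊤ : Submodule R M))
      (Submodule.mkQ_surjective _) t).1 h
    induction s with
    | zero => simp
    | add a b ha hb =>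
      rw [map_add] at h ⊢
      refine add_mem (ha ?_) (hb ?_) <;>
      exact (lTensor_exact X (LinearMap.exact_subtype_mkQ (I • ⊤ : Submodule R M))
        (Submodule.mkQ_surjective _) _).2 ⟨_, rfl⟩
    | tmul x m =>
      have := LinearMap.apply_mem_smul_top (TensorProduct.mk R X M x) m.2
      simpa using this
  · intro h
    exact LinearMap.apply_eq_zero_of_mem_smul_top _ (fun r hr b =>
      smul_tmul_eq_zero_of_right (smul_mkQ_smul_top_eq_zero hr) b) h

theorem rTensor_mkQ_smul_top_eq_zero_iff {I : Ideal R} {X M : Type*} [AddCommGroup X] [Module R X]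
    [AddCommGroup M] [Module R M] (t : X ⊗[R] M) :
    (I • ⊤ : Submodule R X).mkQ.rTensor M t = 0 ↔ t ∈ (I • ⊤ : Submodule R (X ⊗[R] M)) := by
  have h := lTensor_mkQ_smul_top_eq_zero_iff (I := I) (TensorProduct.comm R X M t)
  have hcomm : ∀ s : X ⊗[R] M, (I • ⊤ : Submodule R X).mkQ.lTensor M (TensorProduct.comm R X M s) =
      TensorProduct.comm R _ M ((I • ⊤ : Submodule R X).mkQ.rTensor M s) := fun s =>
    TensorProduct.map_comm _ _ s
  rw [hcomm, LinearEquiv.map_eq_zero_iff] at h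
  rw [h]
  constructor
  · intro h0
    simpa using (TensorProduct.comm R X M).symm.toLinearMap.apply_mem_smul_top h0
  · exact (TensorProduct.comm R X M).toLinearMap.apply_mem_smul_top

theorem IsTotallySeparatedModule.isPureMono_toProdQuotients [IsLocalRing R] {M : Type v}
    [AddCommGroup M] [Module R M] (h : IsTotallySeparatedModule R M) :
    IsPureMono (toProdQuotients R M) := by
  intro X _ _
  refine lTensor_injective_of_finite _ (fun Y _ _ _ => ?_) X
  rw [injective_iff_map_eq_zero]
  intro t ht
  refine (isHausdorff_iff_mem.1 (h Y)) t fun n => ?_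
  rcases Nat.eq_zero_or_pos n with rfl | hn
  · simp
  · rw [← lTensor_mkQ_smul_top_eq_zero_iff]
    have := congrArg ((LinearMap.proj (R := R) (φ := fun n : ℕ+ =>
      M ⧸ (IsLocalRing.maximalIdeal R ^ (n : ℕ) • ⊤ : Submodule R M)) ⟨n, hn⟩).lTensor Y) ht
    rw [← LinearMap.comp_apply, ← LinearMap.lTensor_comp, map_zero] at this
    exact this

theorem IsPureMono.isTotallySeparatedModule_of_toProdQuotients [IsNoetherianRing R] [IsLocalRing R]
    {M : Type v} [AddCommGroup M] [Module R M] (h : IsPureMono (toProdQuotients R M)) :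
    IsTotallySeparatedModule R M := by
  intro X _ _ _
  rw [IsSeparatedModule, isHausdorff_iff_mem]
  intro t ht
  apply (injective_iff_map_eq_zero _).1 (h X)
  apply eq_zero_of_forall_lTensor_proj_eq_zero
  intro n
  rw [← LinearMap.comp_apply, ← LinearMap.lTensor_comp]
  exact (lTensor_mkQ_smul_top_eq_zero_iff t).2 (ht n)

end Separated

/-! ### Limits in pure-injective modules -/

section Limit

variable {R : Type u} [CommRing R]

/-- The submodule of eventually zero sequences. -/
def eventuallyZero (R : Type u) [CommRing R] (N : Type w) [AddCommGroup N] [Module R N] :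
    Submodule R (ℕ → N) where
  carrier := {s | ∀ᶠ k in Filter.atTop, s k = 0}
  zero_mem' := by simp
  add_mem' ha hb := by
    filter_upwards [ha, hb] with k h1 h2
    simp [h1, h2]
  smul_mem' r s hs := by
    filter_upwards [hs] with k h1
    simp [h1]

/-- The diagonal map from `N` to the quotient of `N ^ ℕ` by the eventually zero sequences. -/
def diagonalMkQ (R : Type u) [CommRing R] (N : Type w) [AddCommGroup N] [Module R N] :
    N →ₗ[R] (ℕ → N) ⧸ eventuallyZero R N :=
  (eventuallyZero R N).mkQ ∘ₗ LinearMap.pi fun _ => LinearMap.id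

/-- A tensor is a finite sum, so one coming from eventually zero sequences vanishes at some
coordinate `k`; projection to `k` is a retraction of the diagonal. -/
theorem isPureMono_diagonalMkQ (N : Type w) [AddCommGroup N] [Module R N] :
    IsPureMono (diagonalMkQ R N) := by
  intro X _ _
  rw [injective_iff_map_eq_zero]
  intro t ht
  rw [diagonalMkQ, LinearMap.lTensor_comp, LinearMap.comp_apply] at ht
  obtain ⟨s, hs⟩ := (lTensor_exact X (LinearMap.exact_subtype_mkQ (eventuallyZero R N))
      (Submodule.mkQ_surjective _) _).1 ht
  have key : ∀ s, ∀ᶠ k in Filter.atTop, (LinearMap.proj (R := R) (φ := fun _ : ℕ => N) k).lTensor X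
      ((eventuallyZero R N).subtype.lTensor X s) = 0 := by
    intro s
    induction s with
    | zero => simp
    | add a b ha hb =>
      filter_upwards [ha, hb] with k h1 h2
      rw [map_add, map_add, h1, h2, add_zero]
    | tmul x z =>
      filter_upwards [z.2] with k hk
      simp [hk]
  obtain ⟨k, hk⟩ := (key s).exists
  rw [hs, ← LinearMap.comp_apply, ← LinearMap.lTensor_comp] at hk
  have : LinearMap.proj (R := R) (φ := fun _ : ℕ => N) k ∘ₗ
    LinearMap.pi (fun _ => LinearMap.id) = LinearMap.id := rfl
  rwa [this, LinearMap.lTensor_id] at hk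

/-- A pure-injective module admits a linear "limit" functional on sequences. -/
theorem IsPureInjective.exists_limit {N : Type (max u v)} [AddCommGroup N] [Module R N]
    (hN : IsPureInjective R N) :
    ∃ L : (ℕ → N) →ₗ[R] N, (∀ x, L (fun _ => x) = x) ∧
      ∀ s : ℕ → N, (∀ᶠ k in Filter.atTop, s k = 0) → L s = 0 := by
  obtain ⟨h, hh⟩ := hN N ((ℕ → N) ⧸ eventuallyZero R N) (diagonalMkQ R N) LinearMap.id
    (isPureMono_diagonalMkQ N)
  refine ⟨h ∘ₗ (eventuallyZero R N).mkQ, fun x => LinearMap.congr_fun hh x, fun s hs => ?_⟩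
  have : (eventuallyZero R N).mkQ s = 0 := (Submodule.Quotient.mk_eq_zero _).2 hs
  rw [LinearMap.comp_apply, this, map_zero]

theorem Submodule.mem_span_range_smul_top {A : Type*} [AddCommGroup A] [Module R A] {p : ℕ}
    (r : Fin p → R) {x : A} (hx : x ∈ (Ideal.span (Set.range r) • ⊤ : Submodule R A)) :
    ∃ y : Fin p → A, x = ∑ l, r l • y l := by
  induction hx using Submodule.smul_induction_on' with
  | smul a ha b _ =>
    obtain ⟨c, rfl⟩ := (Submodule.mem_span_range_iff_exists_fun R).1 ha
    exact ⟨fun l => c l • b, by simp [Finset.sum_smul, smul_smul, mul_comm]⟩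
  | add a _ b _ ha hb =>
    obtain ⟨y, rfl⟩ := ha
    obtain ⟨z, rfl⟩ := hb
    exact ⟨y + z, by simp [Finset.sum_add_distrib]⟩

/-- One finite generating family of `I` serves all coordinates at once. -/
theorem Submodule.mem_smul_top_pi {I : Ideal R} (hI : I.FG) {ι : Type*} {A : ι → Type*}
    [∀ i, AddCommGroup (A i)] [∀ i, Module R (A i)] {s : ∀ i, A i}
    (hs : ∀ i, s i ∈ (I • ⊤ : Submodule R (A i))) : s ∈ (I • ⊤ : Submodule R (∀ i, A i)) := by
  obtain ⟨p, r, rfl⟩ := Submodule.fg_iff_exists_fin_generating_family.1 hI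
  choose y hy using fun i => Submodule.mem_span_range_smul_top r (hs i)
  have : s = ∑ l, r l • fun i => y i l := by
    ext i
    simp [← hy]
  rw [this]
  exact Submodule.sum_mem _ fun l _ =>
    Submodule.smul_mem_smul (Submodule.subset_span ⟨l, rfl⟩) trivial

theorem exists_sum_tmul_of_mem_smul_top {I : Ideal R} {X N : Type*} [AddCommGroup X] [Module R X]
    [AddCommGroup N] [Module R N] {k : ℕ} {x : Fin k → X}
    (hx : Submodule.span R (Set.range x) = ⊤) {t : X ⊗[R] N}
    (ht : t ∈ (I • ⊤ : Submodule R (X ⊗[R] N))) :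
    ∃ w : Fin k → N, (∀ i, w i ∈ (I • ⊤ : Submodule R N)) ∧ t = ∑ i, x i ⊗ₜ[R] w i := by
  induction ht using Submodule.smul_induction_on' with
  | smul r hr b _ =>
    obtain ⟨n, rfl⟩ := exists_sum_tmul_of_span_eq_top hx b
    exact ⟨fun i => r • n i, fun i => Submodule.smul_mem_smul hr trivial,
      by simp [Finset.smul_sum]⟩
  | add a _ b _ ha hb =>
    obtain ⟨y, hy, rfl⟩ := ha
    obtain ⟨z, hz, rfl⟩ := hb
    exact ⟨y + z, fun i => add_mem (hy i) (hz i),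
      by simp [TensorProduct.tmul_add, Finset.sum_add_distrib]⟩

/-- A separated pure-injective module over a noetherian local ring is totally separated. -/
theorem IsPureInjective.isTotallySeparatedModule [IsNoetherianRing R] [IsLocalRing R]
    {N : Type (max u v)} [AddCommGroup N] [Module R N] (hN : IsPureInjective R N)
    (hsep : IsSeparatedModule R N) : IsTotallySeparatedModule R N := by
  intro X _ _ _
  rw [IsSeparatedModule, isHausdorff_iff_mem] at hsep ⊢
  intro t ht
  obtain ⟨L, hL1, hL2⟩ := IsPureInjective.exists_limit.{u, v} hN
  obtain ⟨k, x, hx⟩ := Module.Finite.exists_fin (R := R) (M := X)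
  choose w hw htw using fun n => exists_sum_tmul_of_mem_smul_top hx (ht n)
  obtain ⟨y, hy⟩ := exists_sum_tmul_of_span_eq_top hx t
  have heq : ∑ i, x i ⊗ₜ[R] (fun n => w n i) = ∑ i, x i ⊗ₜ[R] (fun _ : ℕ => y i) := by
    rw [← sub_eq_zero]
    apply eq_zero_of_forall_lTensor_proj_eq_zero
    intro n
    simp [← hy, ← htw]
  have hzero : ∀ i, L (fun n => w n i) = 0 := by
    intro i
    refine hsep _ fun j => ?_
    -- `L` ignores the terms before `j`, and the remaining ones all lie in `𝔪ʲN`.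
    have hsplit : (fun n => w n i) = (fun n => if j ≤ n then w n i else 0) +
        fun n => if j ≤ n then 0 else w n i := by
      ext n
      by_cases h : j ≤ n <;> simp [h]
    rw [hsplit, map_add, hL2 (fun n => if j ≤ n then 0 else w n i), add_zero]
    · refine L.apply_mem_smul_top (Submodule.mem_smul_top_pi (IsNoetherian.noetherian _) fun n => ?_)
      by_cases h : j ≤ n
      · simp only [h, if_true]
        exact Submodule.smul_mono_left (Ideal.pow_le_pow_right h) (hw n i)
      · simp [h]
    · filter_upwards [Filter.eventually_ge_atTop j] with n hn
      simp [hn]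
  have := congrArg (L.lTensor X) heq
  simp only [map_sum, LinearMap.lTensor_tmul, hL1, hzero, TensorProduct.tmul_zero,
    Finset.sum_const_zero] at this
  rw [hy, ← this]

theorem IsTotallySeparatedModule.of_isPureMono [IsLocalRing R] {M : Type v} {N : Type w}
    [AddCommGroup M] [Module R M] [AddCommGroup N] [Module R N] {f : M →ₗ[R] N}
    (hf : IsPureMono f) (hN : IsTotallySeparatedModule R N) : IsTotallySeparatedModule R M :=
  fun X _ _ _ => IsHausdorff.of_injective (f.lTensor X) (hf X) (hN X)

end Limit

/-! ### Separatedness of pure-essential extensions -/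

section SeparatedExtension

variable {R : Type u} [CommRing R]

theorem evalCharacter_rTensor_lTensor_curry {M Y Z : Type*} [AddCommGroup M] [Module R M]
    [AddCommGroup Y] [Module R Y] [AddCommGroup Z] [Module R Z]
    (c : CharacterModule (M ⊗[R] Z)) (g : Y →ₗ[R] Z) (t : Y ⊗[R] M) :
    evalCharacter R Z (g.rTensor _ ((CharacterModule.curry c).lTensor Y t)) =
      c (TensorProduct.comm R Z M (g.rTensor M t)) := by
  induction t with
  | zero => simp
  | add a b ha hb => simp only [map_add, ha, hb]
  | tmul y m => rfl

/-- The map from `M` to a product of dual modules given by a family of characters. -/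
noncomputable def dualProductMap {M : Type*} [AddCommGroup M] [Module R M] {ι : Type*}
    {Z : ι → Type*} [∀ i, AddCommGroup (Z i)] [∀ i, Module R (Z i)]
    (c : ∀ i, CharacterModule (M ⊗[R] Z i)) : M →ₗ[R] ∀ i, CharacterModule (Z i) :=
  LinearMap.pi fun i => CharacterModule.curry (c i)

theorem character_eq_zero_of_lTensor_dualProductMap_eq_zero {M : Type*} [AddCommGroup M]
    [Module R M] {ι : Type*} {Z : ι → Type*} [∀ i, AddCommGroup (Z i)] [∀ i, Module R (Z i)]
    {c : ∀ i, CharacterModule (M ⊗[R] Z i)} {Y : Type*} [AddCommGroup Y] [Module R Y]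
    {t : Y ⊗[R] M} (ht : (dualProductMap c).lTensor Y t = 0) (i : ι) (g : Y →ₗ[R] Z i) :
    c i (TensorProduct.comm R (Z i) M (g.rTensor M t)) = 0 := by
  have h := congrArg ((LinearMap.proj (R := R) (φ := fun i => CharacterModule (Z i)) i).lTensor Y) ht
  rw [← LinearMap.comp_apply, ← LinearMap.lTensor_comp, map_zero, dualProductMap,
    LinearMap.proj_pi] at h
  rw [← evalCharacter_rTensor_lTensor_curry, h, map_zero, map_zero]

/-- The index type for the separated pure-injective extension of `M`: finitely generated modules
killed by a power of the maximal ideal, with a character of their tensor product with `M`. -/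
structure TorsionCharacter (R : Type u) [CommRing R] [IsLocalRing R] (M : Type v)
    [AddCommGroup M] [Module R M] where
  /-- the exponent -/
  exponent : ℕ
  /-- the number of generators -/
  rank : ℕ
  /-- the relations -/
  relations : Submodule R (Fin rank → R)
  smul_eq_zero : ∀ r ∈ IsLocalRing.maximalIdeal R ^ exponent,
    ∀ z : (Fin rank → R) ⧸ relations, r • z = 0
  /-- the character -/
  character : CharacterModule (M ⊗[R] ((Fin rank → R) ⧸ relations))

/-- The finitely generated module underlying an index. -/
abbrev TorsionCharacter.Carrier [IsLocalRing R] {M : Type v} [AddCommGroup M] [Module R M]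
    (i : TorsionCharacter R M) : Type u :=
  (Fin i.rank → R) ⧸ i.relations

/-- Characters separate points of `M ⊗ Y/𝔪ᵃY`, so a tensor in the kernel lies in `𝔪ᵃ(Y ⊗ M)` for
every `a`. -/
theorem IsTotallySeparatedModule.isPureMono_dualProductMap [IsLocalRing R] {M : Type v}
    [AddCommGroup M] [Module R M] (h : IsTotallySeparatedModule R M) :
    IsPureMono (dualProductMap (Z := TorsionCharacter.Carrier)
      (TorsionCharacter.character (R := R) (M := M))) := by
  intro X _ _
  refine lTensor_injective_of_finite _ (fun Y _ _ _ => ?_) X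
  rw [injective_iff_map_eq_zero]
  intro t ht
  refine isHausdorff_iff_mem.1 (h Y) t fun a => ?_
  rw [← rTensor_mkQ_smul_top_eq_zero_iff]
  obtain ⟨n, L, ⟨e⟩⟩ := Module.Finite.exists_fin_quot_equiv R
    (Y ⧸ (IsLocalRing.maximalIdeal R ^ a • ⊤ : Submodule R Y))
  have hL : ∀ r ∈ IsLocalRing.maximalIdeal R ^ a, ∀ z : (Fin n → R) ⧸ L, r • z = 0 := by
    intro r hr z
    apply e.injective
    rw [map_smul, map_zero]
    exact smul_mkQ_smul_top_eq_zero hr _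
  have hz : (e.symm.toLinearMap ∘ₗ (IsLocalRing.maximalIdeal R ^ a • ⊤ : Submodule R Y).mkQ).rTensor
      M t = 0 := by
    apply (TensorProduct.comm R _ M).injective
    rw [map_zero]
    exact CharacterModule.eq_zero_of_character_apply fun c =>
      character_eq_zero_of_lTensor_dualProductMap_eq_zero ht ⟨a, n, L, hL, c⟩ _
  rw [LinearMap.rTensor_comp, LinearMap.comp_apply] at hz
  exact (LinearEquiv.map_eq_zero_iff (e.symm.rTensor M)).1 hz

/-- A totally separated module has only separated pure-essential extensions. -/
theorem IsTotallySeparatedModule.isSeparatedModule_of_isPureEssential [IsLocalRing R] {M : Type v}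
    [AddCommGroup M] [Module R M] (h : IsTotallySeparatedModule R M) {N : Type w} [AddCommGroup N]
    [Module R N] {f : M →ₗ[R] N} (hf : IsPureEssential f) : IsSeparatedModule R N := by
  choose g hg using fun i : TorsionCharacter R M =>
    hf.1.exists_extension_characterModule (U := i.Carrier) (CharacterModule.curry i.character)
  have hgf : LinearMap.pi g ∘ₗ f = dualProductMap (Z := TorsionCharacter.Carrier)
      (TorsionCharacter.character (R := R) (M := M)) := by
    refine LinearMap.ext fun m => funext fun i => LinearMap.congr_fun (hg i) m
  have hker : LinearMap.ker (LinearMap.pi g) = ⊥ := by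
    apply hf.2
    -- The pure map out of `M` factors through the quotient of `N` by this kernel, so `M` stays pure
    -- in that quotient.
    apply IsPureMono.of_comp (g := (LinearMap.ker (LinearMap.pi g)).liftQ (LinearMap.pi g) le_rfl)
    rw [← LinearMap.comp_assoc, Submodule.liftQ_mkQ, hgf]
    exact h.isPureMono_dualProductMap
  refine IsHausdorff.of_injective _ (LinearMap.ker_eq_bot.1 hker) (isHausdorff_iff_mem.2 ?_)
  intro x hx
  funext i
  refine LinearMap.apply_eq_zero_of_mem_smul_top (LinearMap.proj (R := R)
    (φ := fun i : TorsionCharacter R M => CharacterModule i.Carrier) i)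
    (fun r hr b => CharacterModule.ext _ fun z => ?_) (hx i.exponent)
  rw [CharacterModule.smul_apply, i.smul_eq_zero r hr, map_zero]
  rfl

end SeparatedExtension

/-! ### Pseudocomplements and essential closures -/

section Lattice

variable {α : Type*} [CompleteLattice α] [IsCompactlyGenerated α]

theorem exists_maximal_disjoint {a b : α} (h : Disjoint a b) :
    ∃ m, b ≤ m ∧ Disjoint a m ∧ ∀ c, m ≤ c → Disjoint a c → c = m := by
  obtain ⟨m, hbm, hm⟩ := zorn_le_nonempty₀ {c | Disjoint a c} (fun C hC hchain y hy =>
    ⟨sSup C, (DirectedOn.disjoint_sSup_right hchain.directedOn).2 fun c hc => hC hc,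
      fun z hz => le_sSup hz⟩) b h
  exact ⟨m, hbm, hm.1, fun c hmc hc => le_antisymm (hm.2 hc hmc) hmc⟩

/-- Every element of a compactly generated modular lattice has an essential extension that is
a relative complement of a pseudocomplement of it. -/
theorem exists_essential_pair [IsModularLattice α] (F : α) : ∃ G H : α, F ≤ H ∧ Disjoint G H ∧
    (∀ S ≤ H, Disjoint F S → S = ⊥) ∧ (∀ G', G ≤ G' → Disjoint F G' → G' = G) ∧
    ∀ H', H ≤ H' → Disjoint G H' → H' = H := by
  obtain ⟨G, -, hG, hGmax⟩ := exists_maximal_disjoint (disjoint_bot_right : Disjoint F ⊥)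
  obtain ⟨H, hFH, hH, hHmax⟩ := exists_maximal_disjoint hG.symm
  refine ⟨G, H, hFH, hH, fun S hS hFS => ?_, hGmax, hHmax⟩
  -- Modularity enters here; maximality of `G` then forces `S ≤ G`.
  have h1 : Disjoint F (S ⊔ G) :=
    hFS.disjoint_sup_right_of_disjoint_sup_left (hH.symm.mono_left (sup_le hFH hS))
  have h2 := hGmax _ le_sup_right h1
  exact (hH.symm.mono_left hS).eq_bot_of_le (h2 ▸ le_sup_left)

end Lattice

/-! ### Existence of pure-injective hulls -/

section Hull

variable {R : Type u} [CommRing R]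

theorem IsPureInjective.characterModule (U : Type w) [AddCommGroup U] [Module R U] :
    IsPureInjective R (CharacterModule U) :=
  fun _ _ _ _ _ _ _ g hi => hi.exists_extension_characterModule g

open TensorProduct.AlgebraTensorModule in
/-- Let `U` be a module having `R` as a retract and such that `U ⊗ U⋆ → Hom(U, U)⋆` is injective.
Then every pure submodule of `U⋆` has a pure-injective hull that is a direct summand of `U⋆`. -/
theorem IsPureMono.exists_isPureInjectiveHull {U : Type w} [AddCommGroup U] [Module R U]
    (hU : ∀ t : U ⊗[R] CharacterModule U,
      (∀ f : U →ₗ[R] U, evalCharacter R U (f.rTensor _ t) = 0) → t = 0)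
    (s : R →ₗ[R] U) (r : U →ₗ[R] R) (hrs : r ∘ₗ s = LinearMap.id)
    {M : Type v} [AddCommGroup M] [Module R M] {j : M →ₗ[R] CharacterModule U}
    (hj : IsPureMono j) :
    ∃ (N : Type w) (_ : AddCommGroup N) (_ : Module R N) (f : M →ₗ[R] N),
      IsPureInjectiveHull f := by
  have hr1 : r (s 1) = 1 := LinearMap.congr_fun hrs 1
  -- The retract `R` of `U` lets identities be transferred from `U ⊗ A` back to `A`.
  have htmul : ∀ {A : Type _} [AddCommGroup A] [Module R A] {a b : A},
      s 1 ⊗ₜ[R] a = s 1 ⊗ₜ[R] b → a = b := by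
    intro A _ _ a b hab
    have := congrArg (TensorProduct.lid R A ∘ r.rTensor A) hab
    simpa [hr1] using this
  let Λ := Module.End R U
  let E := CharacterModule U
  obtain ⟨G, H, hFH, hGH, hess, hGmax, hHmax⟩ :=
    exists_essential_pair (LinearMap.range (lTensor Λ U j))
  -- `H` embeds in the quotient by `G`, so some character `c` agrees with evaluation on `H` and
  -- kills `G`. The endomorphism `φ` of `U⋆` is `c` curried.
  obtain ⟨p, hp⟩ := exists_character_comp_eq (R := ℤ)
    (G.mkQ ∘ₗ H.subtype).toAddMonoidHom.toIntLinearMap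
    ((evalCharacter R U).comp H.subtype.toAddMonoidHom) (by
      intro a ha
      have h1 : (a : U ⊗[R] E) ∈ G := (Submodule.Quotient.mk_eq_zero G).1 ha
      have h2 : (a : U ⊗[R] E) = 0 := Submodule.disjoint_def.1 hGH _ h1 a.2
      change evalCharacter R U (a : U ⊗[R] E) = 0
      rw [h2, map_zero])
  let c : CharacterModule (U ⊗[R] E) := AddMonoidHom.comp p G.mkQ.toAddMonoidHom
  have hcH : ∀ t ∈ H, c t = evalCharacter R U t := fun t ht => hp ⟨t, ht⟩
  have hcG : ∀ t ∈ G, c t = 0 := fun t ht => by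
    change p (Submodule.Quotient.mk t) = 0
    rw [(Submodule.Quotient.mk_eq_zero G).2 ht, map_zero]
  let φ : E →ₗ[R] E := CharacterModule.curry
    (CharacterModule.dual (TensorProduct.comm R E U).toLinearMap c)
  have hφ : ∀ t : U ⊗[R] E, evalCharacter R U (φ.lTensor U t) = c t := by
    intro t
    induction t with
    | zero => simp
    | add a b ha hb => simp only [map_add, ha, hb]
    | tmul u e => rfl
  have hsmul : ∀ (f : Λ) (t : U ⊗[R] E), f.rTensor E t = f • t := fun f t => rfl
  have hφ' : ∀ (f : Λ) (t : U ⊗[R] E),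
      evalCharacter R U (f.rTensor E (φ.lTensor U t)) = c (f • t) := by
    intro f t
    rw [← hφ, ← hsmul, ← LinearMap.comp_apply, ← LinearMap.comp_apply,
      LinearMap.rTensor_comp_lTensor, LinearMap.lTensor_comp_rTensor]
  let Φ : U ⊗[R] E →ₗ[Λ] U ⊗[R] E := lTensor Λ U φ
  have hΦH : ∀ t ∈ H, Φ t = t := by
    intro t ht
    rw [← sub_eq_zero]
    refine hU _ fun f => ?_
    rw [map_sub, map_sub, sub_eq_zero]
    exact (hφ' f t).trans (hcH _ (H.smul_mem f ht))
  have hΦG : ∀ t ∈ G, Φ t = 0 := fun t ht => hU _ fun f =>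
    (hφ' f t).trans (hcG _ (G.smul_mem f ht))
  have hker : ∀ t, Φ (Φ t) = 0 → Φ t = 0 := by
    -- This kernel contains `G` and meets the image of `U ⊗ M` trivially, since `Φ` fixes that
    -- image.
    have : LinearMap.ker (Φ ∘ₗ Φ) = G := by
      apply hGmax
      · intro t ht
        simp [hΦG t ht]
      · rw [Submodule.disjoint_def]
        intro t ht ht'
        have := hFH ht
        simpa [hΦH t this] using ht'
    intro t ht
    apply hΦG
    rw [← this]
    exact ht
  have hrange : LinearMap.range Φ = H := by
    apply hHmax
    · exact fun t ht => ⟨t, hΦH t ht⟩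
    · rw [Submodule.disjoint_def]
      rintro _ ht ⟨t, rfl⟩
      exact hker t (hΦG _ ht)
  have hφφ : ∀ e, φ (φ e) = φ e := fun e => htmul (hΦH (Φ (s 1 ⊗ₜ e)) (hrange ▸ ⟨_, rfl⟩))
  have hφj : ∀ m, φ (j m) = j m := fun m =>
    htmul (hΦH (s 1 ⊗ₜ j m) (hFH ⟨s 1 ⊗ₜ m, rfl⟩))
  let N := LinearMap.range φ
  let ι : N →ₗ[R] E := N.subtype
  have hretr : φ.rangeRestrict ∘ₗ ι = LinearMap.id := by
    ext1 ⟨_, e, rfl⟩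
    exact Subtype.ext (hφφ e)
  have hφι : φ ∘ₗ ι = ι := by
    ext1 ⟨_, e, rfl⟩
    exact hφφ e
  have hιinj : Function.Injective (ι.lTensor U) := by
    have : Function.LeftInverse (φ.rangeRestrict.lTensor U) (ι.lTensor U) := fun x => by
      rw [← LinearMap.comp_apply, ← LinearMap.lTensor_comp, hretr, LinearMap.lTensor_id,
        LinearMap.id_apply]
    exact this.injective
  let f : M →ₗ[R] N := φ.rangeRestrict ∘ₗ j
  have hιf : ι ∘ₗ f = j := LinearMap.ext hφj
  have hpi : IsPureInjective R N :=
    (IsPureInjective.characterModule U).of_retract ι φ.rangeRestrict hretr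
  have hf : IsPureMono f := IsPureMono.of_comp (g := ι) (hιf ▸ hj)
  refine ⟨N, inferInstance, inferInstance, f, ⟨hf, fun X hX => ?_⟩, hpi⟩
  -- Purity of `M` in `N/X` says that the kernel of `U ⊗ N → U ⊗ N/X` misses `U ⊗ M`, so
  -- essentiality inside `H` kills it.
  have hS := hess ((LinearMap.ker (lTensor Λ U X.mkQ)).map (lTensor Λ U ι)) (by
    rintro _ ⟨x, -, rfl⟩
    rw [← hrange]
    refine ⟨ι.lTensor U x, ?_⟩
    change φ.lTensor U (ι.lTensor U x) = ι.lTensor U x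
    rw [← LinearMap.comp_apply, ← LinearMap.lTensor_comp, hφι]) (by
    rw [Submodule.disjoint_def]
    rintro _ ⟨m, rfl⟩ ⟨x, hx, hxm⟩
    change ι.lTensor U x = j.lTensor U m at hxm
    change X.mkQ.lTensor U x = 0 at hx
    rw [← hιf, LinearMap.lTensor_comp] at hxm
    obtain rfl := hιinj hxm
    have : m = 0 := by
      apply (injective_iff_map_eq_zero _).1 (hX.lTensor_injective U)
      rw [LinearMap.lTensor_comp]
      exact hx
    rw [this, map_zero])
  rw [eq_bot_iff]
  intro x hx
  have h1 : ι.lTensor U (s 1 ⊗ₜ x) = 0 := by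
    have : lTensor Λ U ι (s 1 ⊗ₜ x) ∈
        (LinearMap.ker (lTensor Λ U X.mkQ)).map (lTensor Λ U ι) := by
      refine Submodule.mem_map_of_mem ?_
      rw [LinearMap.mem_ker, lTensor_tmul, X.mkQ_apply, (Submodule.Quotient.mk_eq_zero X).2 hx,
        TensorProduct.tmul_zero]
    rw [hS] at this
    exact this
  have h2 : s 1 ⊗ₜ[R] x = 0 := hιinj (h1.trans (map_zero _).symm)
  exact htmul (h2.trans (TensorProduct.tmul_zero _ _).symm)

/-- The index type for a pure-injective extension of `M`: finitely generated modules with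
a character of their tensor product with `M`. -/
structure FiniteCharacter (R : Type u) [CommRing R] (M : Type v)
    [AddCommGroup M] [Module R M] where
  /-- the number of generators -/
  rank : ℕ
  /-- the relations -/
  relations : Submodule R (Fin rank → R)
  /-- the character -/
  character : CharacterModule (M ⊗[R] ((Fin rank → R) ⧸ relations))

/-- The finitely generated module underlying an index. -/
abbrev FiniteCharacter.Carrier {M : Type v} [AddCommGroup M] [Module R M]
    (i : FiniteCharacter R M) : Type u :=
  (Fin i.rank → R) ⧸ i.relations

open DirectSum in
theorem eq_zero_of_forall_evalCharacter_directSum [IsNoetherianRing R] {ι : Type v} {Z : ι → Type w}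
    [∀ i, AddCommGroup (Z i)] [∀ i, Module R (Z i)] [∀ i, Module.Finite R (Z i)]
    (t : (⨁ i, Z i) ⊗[R] CharacterModule (⨁ i, Z i))
    (ht : ∀ f : (⨁ i, Z i) →ₗ[R] (⨁ i, Z i), evalCharacter R _ (f.rTensor _ t) = 0) : t = 0 := by
  classical
  have hcomp : ∀ i, (DirectSum.component R ι Z i).rTensor _ t = 0 := fun i =>
    eq_zero_of_forall_evalCharacter_rTensor_eq_zero _ fun f => by
      rw [← LinearMap.comp_apply, ← LinearMap.rTensor_comp]
      exact ht _
  have hleft : ∀ (t : (⨁ i, Z i) ⊗[R] CharacterModule (⨁ i, Z i)) i,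
      TensorProduct.directSumLeft R R Z (CharacterModule (⨁ i, Z i)) t i =
      (DirectSum.component R ι Z i).rTensor _ t := by
    intro t i
    induction t with
    | zero => simp
    | add a b ha hb => simp only [map_add, DirectSum.add_apply, ha, hb]
    | tmul z c => rw [TensorProduct.directSumLeft_tmul]; rfl
  apply (TensorProduct.directSumLeft R R Z (CharacterModule (⨁ i, Z i))).injective
  rw [map_zero]
  ext1 i
  rw [hleft, hcomp, DirectSum.zero_apply]

open DirectSum in
/-- Every module over a noetherian ring has a pure-injective hull. -/
theorem exists_isPureInjectiveHull [IsNoetherianRing R] (M : Type v) [AddCommGroup M]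
    [Module R M] :
    ∃ (N : Type (max u v)) (_ : AddCommGroup N) (_ : Module R N) (f : M →ₗ[R] N),
      IsPureInjectiveHull f := by
  classical
  let Z : FiniteCharacter R M → Type u := FiniteCharacter.Carrier
  let c : CharacterModule (M ⊗[R] ⨁ i, Z i) :=
    AddMonoidHom.comp (DirectSum.toAddMonoid fun i : FiniteCharacter R M =>
      (i.character : M ⊗[R] Z i →+ AddCircle (1 : ℚ)))
      (TensorProduct.directSumRight R R M Z).toLinearMap.toAddMonoidHom
  have hc : ∀ i (t : M ⊗[R] Z i),
      c ((DirectSum.lof R _ Z i).lTensor M t) = i.character t := by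
    intro i t
    induction t with
    | zero => simp
    | add a b ha hb => simp only [map_add, ha, hb]
    | tmul m z =>
      rw [LinearMap.lTensor_tmul]
      change DirectSum.toAddMonoid (fun i : FiniteCharacter R M =>
        (i.character : M ⊗[R] Z i →+ AddCircle (1 : ℚ)))
        (TensorProduct.directSumRight R R M Z (m ⊗ₜ DirectSum.lof R _ Z i z)) = _
      rw [TensorProduct.directSumRight_tmul_lof]
      exact DirectSum.toAddMonoid_of _ _ _
  have hj : IsPureMono (CharacterModule.curry (R := R) (A := M) (B := ⨁ i, Z i) c) := by
    intro X _ _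
    refine lTensor_injective_of_finite _ (fun Y _ _ _ => ?_) X
    rw [injective_iff_map_eq_zero]
    intro t ht
    obtain ⟨n, L, ⟨e⟩⟩ := Module.Finite.exists_fin_quot_equiv R Y
    apply (e.symm.rTensor M).injective
    apply (TensorProduct.comm R _ M).injective
    rw [map_zero, map_zero]
    refine CharacterModule.eq_zero_of_character_apply fun d => ?_
    rw [← hc ⟨n, L, d⟩]
    have := evalCharacter_rTensor_lTensor_curry (M := M) (Z := ⨁ i, Z i) c
      (DirectSum.lof R _ Z ⟨n, L, d⟩ ∘ₗ e.symm.toLinearMap) t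
    rw [ht, map_zero, map_zero, LinearMap.rTensor_comp] at this
    refine Eq.trans ?_ this.symm
    exact congrArg c (TensorProduct.map_comm _ _ _)
  -- The summand isomorphic to `R`, with the zero character, provides the retract.
  obtain ⟨n, L, ⟨e⟩⟩ := Module.Finite.exists_fin_quot_equiv R R
  refine hj.exists_isPureInjectiveHull (eq_zero_of_forall_evalCharacter_directSum)
    (DirectSum.lof R _ Z ⟨n, L, 0⟩ ∘ₗ e.symm.toLinearMap)
    (e.toLinearMap ∘ₗ DirectSum.component R _ Z ⟨n, L, 0⟩) ?_
  ext
  simp [DirectSum.component.lof_self]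

end Hull

/-- The last two items together say that "the pure-injective hull of `M` is separated" makes
sense: a hull exists, and the condition does not depend on its choice. -/
theorem lemma2p1 (R : Type u) [CommRing R] [IsNoetherianRing R] [IsLocalRing R]
    (M : Type v) [AddCommGroup M] [Module R M] :
    List.TFAE [
      IsTotallySeparatedModule R M,
      IsPureMono (toProdQuotients R M),
      ∃ (N : Type (max u v)) (_ : AddCommGroup N) (_ : Module R N) (f : M →ₗ[R] N),
        IsPureInjectiveHull f ∧ IsSeparatedModule R N,
      ∀ (N : Type (max u v)) [AddCommGroup N] [Module R N] (f : M →ₗ[R] N),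
        IsPureInjectiveHull f → IsSeparatedModule R N] := by
  tfae_have 1 → 2 := IsTotallySeparatedModule.isPureMono_toProdQuotients
  tfae_have 2 → 1 := IsPureMono.isTotallySeparatedModule_of_toProdQuotients
  tfae_have 1 → 4 := fun h N _ _ f hf => h.isSeparatedModule_of_isPureEssential hf.1
  tfae_have 4 → 3 := fun h => by
    obtain ⟨N, _, _, f, hf⟩ := exists_isPureInjectiveHull (R := R) M
    exact ⟨N, _, _, f, hf, h N f hf⟩
  tfae_have 3 → 1 := by
    rintro ⟨N, _, _, f, hf, hN⟩
    exact (IsPureInjective.isTotallySeparatedModule.{u, v} hf.2 hN).of_isPureMono hf.1.1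
  tfae_finish
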